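/- Let $q$ be a prime power, $n\ge 1$, $K=\mathbb F_{q^n}$, let $\sigma:K\to K$, $a\mapsto a^q$, with fixed field $F=\mathbb F_q$, and let $R=K[t;\sigma]$ be the skew polynomial ring, in which $ta=\sigma(a)t$ for $a\in K$. For $c\in K^\times$ and $\alpha\in K$ put $\Omega_c(\alpha)=\sigma(c)\alpha c^{-1}$. Let $f\in R$ be monic of degree $m\ge 1$ such that the greatest common right divisor $(f,t)_r$ of $f$ and $t$ is $1$. The minimal central left multiple of $f$ is a polynomial $h$ of minimal degree among the nonzero elements of the center of $R$ of the form $gf$ with $g\in R$; suppose that it is $h(t)=\hat h(t^n)$ for a monic irreducible polynomial $\hat h\in F[x]$. Call $f$ an A-polynomial if its eigenring $\mathcal E(f)=\{g\in R: fg\in Rf\}/Rf$ is a (finite-dimensional) central simple algebra over $F$. Then $f$ is an A-polynomial if and only if $m\le n$ and there exist $c_1,\dots,c_m,b\in K^\times$ with $c_m=1$ such that $$f(t)=\prod_{i=1}^m\bigl(t-\Omega_{c_i}(b)\bigr)=(t-\Omega_{c_1}(b))(t-\Omega_{c_2}(b))\cdots(t-\Omega_{c_m}(b)).$$ In particular,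 if $f$ is an A-polynomial and $m\neq 1$, then $f$ is reducible in $R$, i.e. $f=gh$ with $g,h\in R$ of degree smaller than $m$. -/

import Mathlib

namespace SkewPolynomial

noncomputable section

/-- `Fix(σ)`: the elements of the field `K` that are fixed by (all powers of) the twist
`σ = SkewPolynomial.φ` of the skew polynomial ring `K[t;σ]`. -/
abbrev FixedField (K : Type*) [Field K] [MulSemiringAction (Multiplicative ℕ) K] :
    Subfield K :=
  FixedPoints.subfield (Multiplicative ℕ) K

/-- Membership in `FixedField K` means being fixed by `σ`. -/
theorem mem_fixedField_iff {K : Type*} [Field K] [MulSemiringAction (Multiplicative ℕ) K]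
    (a : K) : a ∈ FixedField K ↔ (φ : K →+* K) a = a := by
  constructor
  · intro h
    exact h (Multiplicative.ofAdd 1)
  · intro h
    change ∀ j : Multiplicative ℕ, j • a = a
    intro j
    have := φ_iterate_apply (Multiplicative.toAdd j) a
    rw [Function.iterate_fixed h] at this
    exact this.symm

/-- The degree of a skew polynomial, with `degree 0 = ⊥` (that is, `-∞`). -/
def degree {K : Type*} [Field K] (f : SkewPolynomial K) : WithBot ℕ :=
  f.support.max

section Division

variable {K : Type*} [Field K] [MulSemiringAction (Multiplicative ℕ) K]

/-- `g` right divides `f`: `f = k * g` for some `k`. -/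
def RightDvd (g f : SkewPolynomial K) : Prop :=
  ∃ k : SkewPolynomial K, f = k * g

/-- `d` is a greatest common right divisor of `f` and `g`. -/
def IsGCRD (f g d : SkewPolynomial K) : Prop :=
  RightDvd d f ∧ RightDvd d g ∧
    ∀ e : SkewPolynomial K, RightDvd e f → RightDvd e g → RightDvd e d

/-- `f` is reducible: it is a product of two skew polynomials of smaller degree. -/
def IsReducible (f : SkewPolynomial K) : Prop :=
  ∃ g h : SkewPolynomial K, f = g * h ∧ degree g < degree f ∧ degree h < degree f

/-- `h` is a nonzero central left multiple of `f` of minimal degree. -/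
def IsMinimalCentralLeftMultiple (f h : SkewPolynomial K) : Prop :=
  h ∈ Subring.center (SkewPolynomial K) ∧ h ≠ 0 ∧ RightDvd f h ∧
    ∀ h' ∈ Subring.center (SkewPolynomial K), h' ≠ 0 → RightDvd f h' → degree h ≤ degree h'

/-- The map `Ω_v(α) = σ(v) α v⁻¹` (the derivation being zero). -/
def Omega (v : Kˣ) (α : K) : K :=
  φ (v : K) * α * (v : K)⁻¹

end Division

section Eigenring

variable {K : Type*} [Field K] [MulSemiringAction (Multiplicative ℕ) K]

/-- The left idealiser `{g | f g ∈ R f}` of `f` in `R = K[t;σ]`, as an algebra over the field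
fixed by `σ`. -/
def leftIdealiser (f : SkewPolynomial K) : Subalgebra (FixedField K) (SkewPolynomial K) where
  carrier := {g | RightDvd f (f * g)}
  mul_mem' := by
    rintro a b ⟨k, hk⟩ ⟨l, hl⟩
    exact ⟨k * l, by rw [← mul_assoc, hk, mul_assoc, hl, mul_assoc]⟩
  add_mem' := by
    rintro a b ⟨k, hk⟩ ⟨l, hl⟩
    exact ⟨k + l, by rw [mul_add, hk, hl, add_mul]⟩
  algebraMap_mem' := fun r => ⟨algebraMap _ _ r, (Algebra.commutes r f).symm⟩

/-- The left ideal `R f`, as an ideal of the left idealiser of `f`. -/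
def eigenIdeal (f : SkewPolynomial K) : Ideal (leftIdealiser f) where
  carrier := {g | RightDvd f (g : SkewPolynomial K)}
  add_mem' := by
    rintro a b ⟨k, hk⟩ ⟨l, hl⟩
    exact ⟨k + l, by rw [Subalgebra.coe_add, hk, hl, add_mul]⟩
  zero_mem' := ⟨0, by simp⟩
  smul_mem' := by
    rintro c x ⟨k, hk⟩
    exact ⟨c * k, by rw [smul_eq_mul, Subalgebra.coe_mul, hk, mul_assoc]⟩

instance eigenIdeal_isTwoSided (f : SkewPolynomial K) : (eigenIdeal f).IsTwoSided where
  mul_mem_of_left := by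
    rintro a b ⟨k, hk⟩
    obtain ⟨l, hl⟩ := b.2
    exact ⟨k * l, by rw [Subalgebra.coe_mul, hk, mul_assoc, hl, mul_assoc]⟩

/-- The eigenring of `f`: the quotient of the left idealiser of `f` by `R f`. -/
abbrev Eigenring (f : SkewPolynomial K) : Type _ :=
  leftIdealiser f ⧸ eigenIdeal f

/-- `f` is a (generalised) A-polynomial: its eigenring is a (finite-dimensional) central simple
algebra over the field fixed by `σ`. -/
def IsAPolynomial (f : SkewPolynomial K) : Prop :=
  Algebra.IsCentral (FixedField K) (Eigenring f) ∧ IsSimpleRing (Eigenring f) ∧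
    Module.Finite (FixedField K) (Eigenring f)

end Eigenring

end

end SkewPolynomial

/-!
Let `F` be the field fixed by `σ` and `n = [K : F]`. For `b ≠ 0` let `K[t;σ]` act on `K` with `t`
acting as `x ↦ b σ(x)`. A nonzero skew polynomial of degree `m` has a kernel of dimension at most
`m` over `F`; call the kernel full if equality holds. A nonzero element `w` of the kernel amounts to
a right factor `t - Ω_w(b)`, so a polynomial with full kernel `V` splits into factors `t - Ω_c(b)`.
Its eigenring is all of `End_F(V)`, because by a dimension count every `F`-linear map `V → K` comes
from a skew polynomial. The central element `t ^ n` acts as the norm `N(b)`; hence `t ^ n - N(b)`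
acts as zero on `K` and has full kernel, a property inherited by its right divisors.

If the eigenring of `f` is central over `F`, then `t ^ n` is congruent to some `a ∈ F` modulo `Rf`.
Over a finite field `a` is a norm `N(b)`, and `b ≠ 0` because `t` does not divide `f` on the right;
so `f` divides `t ^ n - N(b)`. Conversely, if `t - b` divides `f` on the right, applying the central
multiple `p(t ^ n)` of `f` to `1` gives `p(N(b)) = 0`, so that `p = x - N(b)` and `f` again divides
`t ^ n - N(b)`.
-/

namespace SkewPoly

open SkewPolynomial

variable {K : Type*} [Field K]

section Degree

theorem degree_eq_bot_iff {f : SkewPolynomial K} : degree f = ⊥ ↔ f = 0 := by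
  rw [degree, Finset.max_eq_bot, support_eq_empty]

theorem exists_degree_eq_natCast {f : SkewPolynomial K} (hf : f ≠ 0) :
    ∃ m : ℕ, degree f = m := by
  obtain ⟨m, hm⟩ := WithBot.ne_bot_iff_exists.1 (mt degree_eq_bot_iff.1 hf)
  exact ⟨m, hm.symm⟩

theorem coeff_eq_zero_of_degree_lt {f : SkewPolynomial K} {i : ℕ} (h : degree f < i) :
    coeff f i = 0 :=
  notMem_support_iff.1 (Finset.notMem_of_max_lt_coe h)

theorem degree_lt_iff_coeff_zero {f : SkewPolynomial K} {m : ℕ} :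
    degree f < m ↔ ∀ i, m ≤ i → coeff f i = 0 := by
  refine ⟨fun h i hi => coeff_eq_zero_of_degree_lt (h.trans_le (Nat.cast_le.2 hi)), fun h => ?_⟩
  refine (Finset.sup_lt_iff (WithBot.bot_lt_coe m)).2 fun i hi => Nat.cast_lt.2 ?_
  exact not_le.1 fun hmi => mem_support_iff.1 hi (h i hmi)

theorem degree_le_iff_coeff_zero {f : SkewPolynomial K} {m : ℕ} :
    degree f ≤ m ↔ ∀ i, m < i → coeff f i = 0 := by
  refine ⟨fun h i hi => coeff_eq_zero_of_degree_lt (h.trans_lt (Nat.cast_lt.2 hi)), fun h => ?_⟩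
  refine Finset.max_le fun i hi => Nat.cast_le.2 ?_
  exact not_lt.1 fun hmi => mem_support_iff.1 hi (h i hmi)

theorem degree_lt_of_degree_le_of_coeff_eq_zero {f : SkewPolynomial K} {m : ℕ}
    (hf : degree f ≤ m) (hm : coeff f m = 0) : degree f < m := by
  refine degree_lt_iff_coeff_zero.2 fun i hi => ?_
  rcases hi.eq_or_lt with rfl | hi
  · exact hm
  · exact degree_le_iff_coeff_zero.1 hf i hi

theorem le_degree_of_coeff_ne_zero {f : SkewPolynomial K} {m : ℕ} (h : coeff f m ≠ 0) :
    (m : WithBot ℕ) ≤ degree f :=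
  Finset.le_max (mem_support_iff.2 h)

theorem degree_eq_iff {f : SkewPolynomial K} {m : ℕ} :
    degree f = m ↔ degree f ≤ m ∧ coeff f m ≠ 0 :=
  ⟨fun h => ⟨h.le, mem_support_iff.1 (Finset.mem_of_max h)⟩,
    fun h => h.1.antisymm (le_degree_of_coeff_ne_zero h.2)⟩

theorem degree_monomial_le (m : ℕ) (a : K) : degree (monomial m a) ≤ m :=
  degree_le_iff_coeff_zero.2 fun i hi => by rw [coeff_monomial, if_neg hi.ne]

theorem eq_C_of_degree_lt_one {f : SkewPolynomial K} (hf : degree f < 1) : f = C (coeff f 0) := by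
  have hf : degree f < (1 : ℕ) := hf
  ext (_ | i)
  · rw [coeff_C_zero]
  · rw [coeff_C_succ, degree_lt_iff_coeff_zero.1 hf _ (Nat.le_add_left 1 i)]

theorem coeff_sum {ι : Type*} (s : Finset ι) (f : ι → SkewPolynomial K) (j : ℕ) :
    coeff (∑ i ∈ s, f i) j = ∑ i ∈ s, coeff (f i) j :=
  map_sum (AddMonoidHom.mk' (fun p : SkewPolynomial K => coeff p j) fun p r => coeff_add p r j) f s

theorem coeff_sum_monomial {m : ℕ} (v : Fin m → K) (i : Fin m) :
    coeff (∑ j : Fin m, monomial (j : ℕ) (v j)) i = v i := by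
  rw [coeff_sum, Finset.sum_eq_single_of_mem i (Finset.mem_univ i), coeff_monomial, if_pos rfl]
  exact fun j _ hj => by rw [coeff_monomial, if_neg (Fin.val_ne_of_ne hj)]

theorem degree_sum_monomial_lt {m : ℕ} (v : Fin m → K) :
    degree (∑ j : Fin m, monomial (j : ℕ) (v j)) < m := by
  refine degree_lt_iff_coeff_zero.2 fun i hi => ?_
  rw [coeff_sum]
  exact Finset.sum_eq_zero fun j _ => by rw [coeff_monomial, if_neg (j.2.trans_le hi).ne]

end Degree

variable [MulSemiringAction (Multiplicative ℕ) K]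

section Multiplication

theorem coeff_mul_eq_sum_antidiagonal (f g : SkewPolynomial K) (k : ℕ) :
    coeff (f * g) k =
      ∑ p ∈ Finset.HasAntidiagonal.antidiagonal k,
        coeff f p.1 * (φ : K →+* K)^[p.1] (coeff g p.2) := by
  simp only [φ_iterate_apply]
  exact SkewMonoidAlgebra.coeff_mul_antidiagonal_of_finset f g (Multiplicative.ofAdd k)
    (show Finset (Multiplicative ℕ × Multiplicative ℕ) from
      Finset.HasAntidiagonal.antidiagonal (A := ℕ) k)
    (fun {p} => Finset.HasAntidiagonal.mem_antidiagonal (A := ℕ) (n := k) (a := p))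

theorem coeff_mul_add_of_degree_le {f g : SkewPolynomial K} {d e : ℕ} (hf : degree f ≤ d)
    (hg : degree g ≤ e) : coeff (f * g) (d + e) = coeff f d * (φ : K →+* K)^[d] (coeff g e) := by
  rw [coeff_mul_eq_sum_antidiagonal, Finset.sum_eq_single_of_mem (d, e) (by simp)]
  rintro ⟨i, j⟩ hij hne
  rw [Finset.HasAntidiagonal.mem_antidiagonal] at hij
  rcases lt_trichotomy i d with h | rfl | h
  · rw [degree_le_iff_coeff_zero.1 hg j (by lia), iterate_map_zero, mul_zero]
  · exact absurd (congrArg (Prod.mk i) (Nat.add_left_cancel hij)) hne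
  · rw [degree_le_iff_coeff_zero.1 hf i h, zero_mul]

theorem coeff_mul_of_forall_lt {f g : SkewPolynomial K} {i : ℕ} (hf : ∀ j < i, coeff f j = 0) :
    coeff (f * g) i = coeff f i * (φ : K →+* K)^[i] (coeff g 0) := by
  rw [coeff_mul_eq_sum_antidiagonal, Finset.sum_eq_single_of_mem (i, 0) (by simp)]
  rintro ⟨j, l⟩ hjl hne
  rw [Finset.HasAntidiagonal.mem_antidiagonal] at hjl
  rw [hf j (by grind), zero_mul]

theorem iterate_φ_ne_zero (i : ℕ) {a : K} (ha : a ≠ 0) : (φ : K →+* K)^[i] a ≠ 0 :=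
  fun h => ha ((φ : K →+* K).injective.iterate i (h.trans (iterate_map_zero _ i).symm))

theorem degree_mul (f g : SkewPolynomial K) : degree (f * g) = degree f + degree g := by
  rcases eq_or_ne f 0 with rfl | hf
  · rw [zero_mul, degree_eq_bot_iff.2 rfl, WithBot.bot_add]
  rcases eq_or_ne g 0 with rfl | hg
  · rw [mul_zero, degree_eq_bot_iff.2 rfl, WithBot.add_bot]
  obtain ⟨d, hd⟩ := exists_degree_eq_natCast hf
  obtain ⟨e, he⟩ := exists_degree_eq_natCast hg
  rw [hd, he, ← Nat.cast_add]
  refine degree_eq_iff.2 ⟨degree_le_iff_coeff_zero.2 fun k hk => ?_, ?_⟩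
  · obtain ⟨j, rfl⟩ := Nat.exists_eq_add_of_lt hk
    have hej : degree g < (e + j + 1 : ℕ) := he ▸ Nat.cast_lt.2 (by lia)
    rw [add_assoc d, add_assoc d, coeff_mul_add_of_degree_le hd.le hej.le,
      coeff_eq_zero_of_degree_lt hej, iterate_map_zero, mul_zero]
  · rw [coeff_mul_add_of_degree_le hd.le he.le]
    exact mul_ne_zero (degree_eq_iff.1 hd).2 (iterate_φ_ne_zero d (degree_eq_iff.1 he).2)

theorem degree_X_pow (n : ℕ) : degree ((X : SkewPolynomial K) ^ n) = n := by
  rw [X_pow_eq_monomial]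
  refine degree_eq_iff.2 ⟨degree_monomial_le n 1, ?_⟩
  rw [coeff_monomial, if_pos rfl]
  exact one_ne_zero

theorem coeff_X_pow_sub_C (n : ℕ) (a : K) {i : ℕ} (hi : i ≠ 0) :
    coeff ((X : SkewPolynomial K) ^ n - C a) i = if n = i then 1 else 0 := by
  rw [X_pow_eq_monomial, coeff_sub, coeff_monomial, coeff_C_ne_zero hi, sub_zero]

theorem degree_X_pow_sub_C {n : ℕ} (hn : n ≠ 0) (a : K) :
    degree ((X : SkewPolynomial K) ^ n - C a) = n := by
  refine degree_eq_iff.2 ⟨degree_le_iff_coeff_zero.2 fun i hi => ?_, ?_⟩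
  · rw [coeff_X_pow_sub_C n a (Nat.ne_zero_of_lt hi), if_neg hi.ne]
  · rw [coeff_X_pow_sub_C n a hn, if_pos rfl]
    exact one_ne_zero

theorem degree_X_sub_C (a : K) : degree (X - C a) = 1 := by
  simpa only [pow_one, Nat.cast_one] using degree_X_pow_sub_C one_ne_zero a

theorem X_sub_C_ne_zero (a : K) : X - C a ≠ 0 :=
  mt degree_eq_bot_iff.2 (by rw [degree_X_sub_C]; exact WithBot.one_ne_bot)

theorem coeff_mul_X_sub_C_succ {f : SkewPolynomial K} {m : ℕ} (hf : degree f ≤ m) (a : K) :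
    coeff (f * (X - C a)) (m + 1) = coeff f m := by
  rw [coeff_mul_add_of_degree_le (e := 1) hf (degree_X_sub_C a).le, coeff_sub, coeff_X_one,
    coeff_C_succ, sub_zero, iterate_map_one, mul_one]

theorem degree_of_degree_mul_X_sub_C {f : SkewPolynomial K} {m : ℕ} {a : K}
    (h : degree (f * (X - C a)) = (m + 1 : ℕ)) : degree f = m := by
  rw [degree_mul, degree_X_sub_C, Nat.cast_add, Nat.cast_one] at h
  exact (WithBot.add_right_inj WithBot.one_ne_bot).1 h

theorem isReducible_mul {g h : SkewPolynomial K} (hg : 0 < degree g) (hh : 0 < degree h) :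
    IsReducible (g * h) := by
  obtain ⟨d, hd⟩ := exists_degree_eq_natCast (mt degree_eq_bot_iff.2 hg.ne_bot)
  obtain ⟨e, he⟩ := exists_degree_eq_natCast (mt degree_eq_bot_iff.2 hh.ne_bot)
  rw [hd, Nat.cast_pos] at hg
  rw [he, Nat.cast_pos] at hh
  refine ⟨g, h, rfl, ?_, ?_⟩
  · rw [degree_mul, hd, he, ← Nat.cast_add]
    exact Nat.cast_lt.2 (Nat.lt_add_of_pos_right hh)
  · rw [degree_mul, hd, he, ← Nat.cast_add]
    exact Nat.cast_lt.2 (Nat.lt_add_of_pos_left hg)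

end Multiplication

section Division

theorem exists_degree_sub_monomial_mul_lt {f g : SkewPolynomial K} (hf : f ≠ 0)
    (hfg : degree f ≤ degree g) : ∃ j c, degree (g - monomial j c * f) < degree g := by
  obtain ⟨m, hm⟩ := exists_degree_eq_natCast hf
  have hg : g ≠ 0 := by
    rintro rfl
    exact hf (degree_eq_bot_iff.1 (le_bot_iff.1 (hfg.trans_eq (degree_eq_bot_iff.2 rfl))))
  obtain ⟨d, hd⟩ := exists_degree_eq_natCast hg
  rw [hm, hd, Nat.cast_le] at hfg
  obtain ⟨j, rfl⟩ := Nat.exists_eq_add_of_le' hfg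
  refine ⟨j, coeff g (j + m) / (φ : K →+* K)^[j] (coeff f m), ?_⟩
  set c := coeff g (j + m) / (φ : K →+* K)^[j] (coeff f m)
  rw [hd]
  refine degree_lt_of_degree_le_of_coeff_eq_zero (degree_le_iff_coeff_zero.2 fun i hi => ?_) ?_
  · have hmul : degree (monomial j c * f) ≤ (j + m : ℕ) := by
      rw [degree_mul, hm, Nat.cast_add]
      exact add_le_add_left (degree_monomial_le j c) _
    rw [coeff_sub, degree_le_iff_coeff_zero.1 hd.le i hi, degree_le_iff_coeff_zero.1 hmul i hi,
      sub_zero]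
  · rw [coeff_sub, coeff_mul_add_of_degree_le (degree_monomial_le j c) hm.le, coeff_monomial,
      if_pos rfl, div_mul_cancel₀ _ (iterate_φ_ne_zero j (degree_eq_iff.1 hm).2), sub_self]

theorem exists_eq_mul_add_degree_lt {f : SkewPolynomial K} (hf : f ≠ 0) (g : SkewPolynomial K) :
    ∃ k r, g = k * f + r ∧ degree r < degree f := by
  induction hd : degree g using WellFoundedLT.induction generalizing g with
  | ind d ih =>
    rcases lt_or_ge (degree g) (degree f) with hlt | hle
    · exact ⟨0, g, by rw [zero_mul, zero_add], hlt⟩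
    · obtain ⟨j, c, hc⟩ := exists_degree_sub_monomial_mul_lt hf hle
      obtain ⟨k, r, hk, hr⟩ := ih _ (hd ▸ hc) _ rfl
      exact ⟨k + monomial j c, r, by rw [add_mul, add_right_comm, ← hk, sub_add_cancel], hr⟩

theorem exists_eq_mul_X_sub_C_add_C (f : SkewPolynomial K) (a : K) :
    ∃ k r, f = k * (X - C a) + C r := by
  obtain ⟨k, r, hk, hr⟩ := exists_eq_mul_add_degree_lt (X_sub_C_ne_zero a) f
  exact ⟨k, coeff r 0, by rwa [← eq_C_of_degree_lt_one (degree_X_sub_C a ▸ hr)]⟩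

theorem X_rightDvd_iff {f : SkewPolynomial K} : X.RightDvd f ↔ coeff f 0 = 0 := by
  have coeff_mul_X_zero (k : SkewPolynomial K) : coeff (k * X) 0 = 0 := by
    rw [coeff_mul_of_forall_lt (by simp), coeff_X_zero, iterate_map_zero, mul_zero]
  constructor
  · rintro ⟨k, rfl⟩
    exact coeff_mul_X_zero k
  · intro h
    obtain ⟨k, r, rfl⟩ := exists_eq_mul_X_sub_C_add_C f 0
    rw [C_0, sub_zero, coeff_add, coeff_mul_X_zero, coeff_C_zero, zero_add] at h
    exact ⟨k, by rw [h, C_0, sub_zero, add_zero]⟩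

theorem coeff_zero_ne_zero_of_isGCRD {f : SkewPolynomial K} (h : IsGCRD f X 1) :
    coeff f 0 ≠ 0 := by
  intro h0
  have hX : (X : SkewPolynomial K).RightDvd 1 :=
    h.2.2 X (X_rightDvd_iff.2 h0) ⟨1, (one_mul X).symm⟩
  exact one_ne_zero (coeff_one_zero.symm.trans (X_rightDvd_iff.1 hX))

theorem degree_eq_zero_of_rightDvd_X_pow {f : SkewPolynomial K} (h0 : coeff f 0 ≠ 0) {n : ℕ}
    (h : f.RightDvd (X ^ n)) : degree f = 0 := by
  obtain ⟨g, hg⟩ := h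
  have hlow : ∀ i < n, coeff g i = 0 := fun i hi => by
    induction i using Nat.strong_induction_on with
    | h i ih =>
      have hcoeff : coeff g i * (φ : K →+* K)^[i] (coeff f 0) = 0 := by
        rw [← coeff_mul_of_forall_lt fun j hj => ih j hj (hj.trans hi), ← hg, X_pow_eq_monomial,
          coeff_monomial, if_neg hi.ne']
      exact (mul_eq_zero.1 hcoeff).resolve_right (iterate_φ_ne_zero i h0)
  have hne : g * f ≠ 0 := fun h0 => by
    simpa only [hg, degree_eq_bot_iff.2 h0, WithBot.bot_ne_natCast] using degree_X_pow (K := K) n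
  obtain ⟨d, hd⟩ := exists_degree_eq_natCast (left_ne_zero_of_mul hne)
  obtain ⟨e, he⟩ := exists_degree_eq_natCast (right_ne_zero_of_mul hne)
  have hnd : n ≤ d := not_lt.1 fun hdn => (degree_eq_iff.1 hd).2 (hlow d hdn)
  have hdeg : (n : WithBot ℕ) = (d + e : ℕ) := by
    rw [← degree_X_pow (K := K), hg, degree_mul, hd, he, Nat.cast_add]
  rw [he]
  norm_cast at hdeg ⊢
  lia

end Division

noncomputable section Operator

/-- The pseudo-linear transformation `x ↦ b σ(x)` of `K`, which is linear over the field fixed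
by `σ`. -/
def pseudoLinear (b : K) : Module.End (FixedField K) K :=
  LinearMap.mulLeft (FixedField K) b *
    DistribSMul.toLinearMap (FixedField K) K (Multiplicative.ofAdd 1 : Multiplicative ℕ)

theorem pseudoLinear_apply (b x : K) : pseudoLinear b x = b * (φ : K →+* K) x :=
  rfl

theorem pseudoLinear_pow_mul (b c x : K) (i : ℕ) :
    (pseudoLinear b ^ i) (c * x) = (φ : K →+* K)^[i] c * (pseudoLinear b ^ i) x := by
  induction i with
  | zero => rfl
  | succ i ih =>
    rw [pow_succ', Module.End.mul_apply, Module.End.mul_apply, ih, pseudoLinear_apply,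
      pseudoLinear_apply, map_mul, Function.iterate_succ_apply', mul_left_comm]

theorem pseudoLinear_pow_apply (b x : K) (i : ℕ) :
    (pseudoLinear b ^ i) x =
      (∏ j ∈ Finset.range i, (φ : K →+* K)^[j] b) * (φ : K →+* K)^[i] x := by
  have apply_one : (pseudoLinear b ^ i) 1 = ∏ j ∈ Finset.range i, (φ : K →+* K)^[j] b := by
    induction i with
    | zero => rfl
    | succ i ih =>
      rw [pow_succ, Module.End.mul_apply, pseudoLinear_apply, map_one, pseudoLinear_pow_mul, ih,
        Finset.prod_range_succ, mul_comm]
  rw [← mul_one x, pseudoLinear_pow_mul, apply_one, mul_one, mul_comm]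

/-- The action of `K[t;σ]` on `K` in which constants act by multiplication and `t` acts as
`pseudoLinear b`. -/
def operatorEval (b : K) : SkewPolynomial K →ₐ[FixedField K] Module.End (FixedField K) K :=
  SkewMonoidAlgebra.liftNCAlgHom (Algebra.lmul (FixedField K) K)
    (powersHom (Module.End (FixedField K) K) (pseudoLinear b)) (by
      intro c i
      ext x
      have h := pseudoLinear_pow_mul b c x (Multiplicative.toAdd i)
      rw [φ_iterate_apply] at h
      exact h.symm)

theorem operatorEval_monomial_apply (b : K) (i : ℕ) (c x : K) :
    operatorEval b (monomial i c) x = c * (pseudoLinear b ^ i) x := by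
  have h : operatorEval b (monomial i c) =
      Algebra.lmul (FixedField K) K c * pseudoLinear b ^ i :=
    SkewMonoidAlgebra.liftNC_single _ _ _ _
  rw [h, Module.End.mul_apply, Algebra.coe_lmul_eq_mul, LinearMap.mul_apply']

theorem operatorEval_C_apply (b c x : K) : operatorEval b (C c) x = c * x :=
  operatorEval_monomial_apply b 0 c x

theorem operatorEval_X (b : K) : operatorEval b X = pseudoLinear b := by
  ext x
  rw [← monomial_one_one_eq_X, operatorEval_monomial_apply, pow_one, one_mul]

theorem operatorEval_X_sub_C_Omega_apply (b : K) (w : Kˣ) (x : K) :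
    operatorEval b (X - C (Omega w b)) x = b * ((φ : K →+* K) x - (φ : K →+* K) w * (x / w)) := by
  rw [map_sub, LinearMap.sub_apply, operatorEval_X, operatorEval_C_apply, pseudoLinear_apply,
    Omega]
  ring

theorem rightDvd_X_sub_C_Omega_iff {b : K} {w : Kˣ} {f : SkewPolynomial K} :
    (X - C (Omega w b)).RightDvd f ↔ operatorEval b f w = 0 := by
  have self_apply : operatorEval b (X - C (Omega w b)) w = 0 := by
    rw [operatorEval_X_sub_C_Omega_apply, div_self w.ne_zero, mul_one, sub_self, mul_zero]
  constructor
  · rintro ⟨k, rfl⟩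
    rw [map_mul, Module.End.mul_apply, self_apply, map_zero]
  · intro h
    obtain ⟨k, r, rfl⟩ := exists_eq_mul_X_sub_C_add_C f (Omega w b)
    rw [map_add, LinearMap.add_apply, map_mul, Module.End.mul_apply, self_apply, map_zero,
      zero_add, operatorEval_C_apply] at h
    exact ⟨k, by rw [(mul_eq_zero.1 h).resolve_right w.ne_zero, C_0, add_zero]⟩

theorem Omega_one (b : K) : Omega 1 b = b := by
  rw [Omega, Units.val_one, map_one, one_mul, inv_one, mul_one]

theorem Omega_div_Omega (v w : Kˣ) (b : K) : Omega (v / w) (Omega w b) = Omega v b := by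
  have hw : (φ : K →+* K) w ≠ 0 := (map_ne_zero _).2 w.ne_zero
  simp only [Omega, div_eq_mul_inv, Units.val_mul, Units.val_inv_eq_inv_val, map_mul, map_inv₀]
  field_simp

theorem Omega_ne_zero (w : Kˣ) {b : K} (hb : b ≠ 0) : Omega w b ≠ 0 :=
  mul_ne_zero (mul_ne_zero ((map_ne_zero _).2 w.ne_zero) hb) (inv_ne_zero w.ne_zero)

end Operator

section KernelBound

theorem rank_ker_mul_le {F V : Type*} [Field F] [AddCommGroup V] [Module F V]
    (S T : Module.End F V) :
    Module.rank F (LinearMap.ker (S * T)) ≤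
      Module.rank F (LinearMap.ker S) + Module.rank F (LinearMap.ker T) := by
  let T' : LinearMap.ker (S * T) →ₗ[F] LinearMap.ker S := T.restrict fun _ hx => hx
  have ker_le : Module.rank F (LinearMap.ker T') ≤ Module.rank F (LinearMap.ker T) := by
    rw [(Submodule.equivSubtypeMap _ (LinearMap.ker T')).rank_eq]
    exact Submodule.rank_mono (Submodule.map_le_iff_le_comap.2 fun x hx =>
      congrArg Subtype.val (LinearMap.mem_ker.1 hx))
  rw [← LinearMap.rank_range_add_rank_ker T']
  exact add_le_add (Submodule.rank_le _) ker_le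

theorem rank_ker_operatorEval_X_sub_C_Omega_le {b : K} (hb : b ≠ 0) (w : Kˣ) :
    Module.rank (FixedField K) (LinearMap.ker (operatorEval b (X - C (Omega w b)))) ≤ 1 := by
  refine (rank_submodule_le_one_iff' _).2 ⟨(w : K), fun x hx => ?_⟩
  have hφ : (φ : K →+* K) (x / w) = x / w := by
    have hw : (φ : K →+* K) w ≠ 0 := (map_ne_zero _).2 w.ne_zero
    rw [LinearMap.mem_ker, operatorEval_X_sub_C_Omega_apply, mul_eq_zero, or_iff_right hb,
      sub_eq_zero] at hx
    rw [map_div₀, hx, mul_div_cancel_left₀ _ hw]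
  exact Submodule.mem_span_singleton.2
    ⟨⟨x / w, (mem_fixedField_iff _).2 hφ⟩, div_mul_cancel₀ x w.ne_zero⟩

theorem rank_ker_operatorEval_le {b : K} (hb : b ≠ 0) {f : SkewPolynomial K} {m : ℕ}
    (hf : degree f = m) : Module.rank (FixedField K) (LinearMap.ker (operatorEval b f)) ≤ m := by
  induction m generalizing f with
  | zero =>
    have hf0 : coeff f 0 ≠ 0 := (degree_eq_iff.1 hf).2
    have hC : f = C (coeff f 0) := eq_C_of_degree_lt_one (hf.trans_lt (Nat.cast_lt.2 zero_lt_one))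
    have hker : LinearMap.ker (operatorEval b f) = ⊥ := LinearMap.ker_eq_bot'.2 fun x hx => by
      rw [hC, operatorEval_C_apply] at hx
      exact (mul_eq_zero.1 hx).resolve_left hf0
    rw [hker, rank_bot]
    exact zero_le
  | succ m ih =>
    rcases eq_or_ne (LinearMap.ker (operatorEval b f)) ⊥ with hker | hker
    · rw [hker, rank_bot]
      exact zero_le
    obtain ⟨w, hw, hw0⟩ := Submodule.exists_mem_ne_zero_of_ne_bot hker
    obtain ⟨k, rfl⟩ := (rightDvd_X_sub_C_Omega_iff (w := Units.mk0 w hw0)).2 hw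
    rw [map_mul, Nat.cast_succ]
    exact (rank_ker_mul_le _ _).trans
      (add_le_add (ih (degree_of_degree_mul_X_sub_C hf))
        (rank_ker_operatorEval_X_sub_C_Omega_le hb _))

theorem finite_ker_operatorEval {b : K} (hb : b ≠ 0) {f : SkewPolynomial K} (hf : f ≠ 0) :
    Module.Finite (FixedField K) (LinearMap.ker (operatorEval b f)) := by
  obtain ⟨m, hm⟩ := exists_degree_eq_natCast hf
  exact Module.rank_lt_aleph0_iff.1
    ((rank_ker_operatorEval_le hb hm).trans_lt Cardinal.natCast_lt_aleph0)

theorem finrank_ker_operatorEval_le {b : K} (hb : b ≠ 0) {f : SkewPolynomial K} {m : ℕ}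
    (hf : degree f = m) :
    Module.finrank (FixedField K) (LinearMap.ker (operatorEval b f)) ≤ m :=
  Module.finrank_le_of_rank_le (rank_ker_operatorEval_le hb hf)

theorem eq_zero_of_degree_lt_finrank {b : K} (hb : b ≠ 0) {V : Submodule (FixedField K) K}
    {f : SkewPolynomial K} (hf : degree f < (Module.finrank (FixedField K) V : ℕ))
    (hV : V ≤ LinearMap.ker (operatorEval b f)) : f = 0 := by
  by_contra h0
  obtain ⟨m, hm⟩ := exists_degree_eq_natCast h0
  have := finite_ker_operatorEval hb h0
  rw [hm, Nat.cast_lt] at hf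
  exact hf.not_ge ((Submodule.finrank_mono hV).trans (finrank_ker_operatorEval_le hb hm))

end KernelBound

section FullKernel

variable {b : K} {f : SkewPolynomial K}

/-- The kernel of `f`, acting on `K` with `t` as `x ↦ b σ(x)`, has the largest dimension over the
fixed field that the degree of `f` allows. For `b ≠ 0` this forces the kernel to be
finite-dimensional, so that `finrank` does not take its junk value. -/
def HasFullKernel (b : K) (f : SkewPolynomial K) : Prop :=
  degree f = (Module.finrank (FixedField K) (LinearMap.ker (operatorEval b f)) : ℕ)

theorem HasFullKernel.ne_zero (hf : HasFullKernel b f) : f ≠ 0 := fun h =>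
  WithBot.natCast_ne_bot _ (hf.symm.trans (degree_eq_bot_iff.2 h))

theorem HasFullKernel.of_mul (hb : b ≠ 0) {g : SkewPolynomial K}
    (h : HasFullKernel b (g * f)) : HasFullKernel b g ∧ HasFullKernel b f := by
  have hg : g ≠ 0 := left_ne_zero_of_mul h.ne_zero
  have hf : f ≠ 0 := right_ne_zero_of_mul h.ne_zero
  obtain ⟨d, hd⟩ := exists_degree_eq_natCast hg
  obtain ⟨e, he⟩ := exists_degree_eq_natCast hf
  have := finite_ker_operatorEval hb hg
  have := finite_ker_operatorEval hb hf
  have hsum : Module.finrank (FixedField K) (LinearMap.ker (operatorEval b (g * f))) ≤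
      Module.finrank (FixedField K) (LinearMap.ker (operatorEval b g)) +
        Module.finrank (FixedField K) (LinearMap.ker (operatorEval b f)) := by
    refine Module.finrank_le_of_rank_le ?_
    rw [map_mul, Nat.cast_add, Module.finrank_eq_rank, Module.finrank_eq_rank]
    exact rank_ker_mul_le _ _
  have hgd := finrank_ker_operatorEval_le hb hd
  have hfe := finrank_ker_operatorEval_le hb he
  have htotal := h
  rw [HasFullKernel, degree_mul, hd, he, ← Nat.cast_add, Nat.cast_inj] at htotal
  rw [HasFullKernel, HasFullKernel, hd, he, Nat.cast_inj, Nat.cast_inj]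
  lia

theorem HasFullKernel.rightDvd_iff (hb : b ≠ 0) (hf : HasFullKernel b f)
    {g : SkewPolynomial K} :
    f.RightDvd g ↔ LinearMap.ker (operatorEval b f) ≤ LinearMap.ker (operatorEval b g) := by
  constructor
  · rintro ⟨k, rfl⟩ x hx
    rw [LinearMap.mem_ker, map_mul, Module.End.mul_apply, LinearMap.mem_ker.1 hx, map_zero]
  · intro h
    obtain ⟨k, r, rfl, hr⟩ := exists_eq_mul_add_degree_lt hf.ne_zero g
    have hr0 : r = 0 := eq_zero_of_degree_lt_finrank hb (hr.trans_eq hf) fun x hx => by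
      have hx' := LinearMap.mem_ker.1 (h hx)
      rwa [map_add, LinearMap.add_apply, map_mul, Module.End.mul_apply, LinearMap.mem_ker.1 hx,
        map_zero, zero_add] at hx'
    exact ⟨k, by rw [hr0, add_zero]⟩

theorem exists_operatorEval_eq (hb : b ≠ 0) (V : Submodule (FixedField K) K)
    [Module.Finite (FixedField K) V] (T : V →ₗ[FixedField K] K) :
    ∃ g : SkewPolynomial K, ∀ x : V, operatorEval b g x = T x := by
  let v : Fin (Module.finrank (FixedField K) V) → V →ₗ[FixedField K] K :=
    fun i => (pseudoLinear b ^ (i : ℕ)) ∘ₗ V.subtype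
  have sum_apply (c : Fin (Module.finrank (FixedField K) V) → K) (x : V) :
      operatorEval b (∑ i : Fin _, monomial (i : ℕ) (c i)) x = (∑ i, c i • v i) x := by
    simp only [map_sum, LinearMap.sum_apply, operatorEval_monomial_apply, LinearMap.smul_apply,
      smul_eq_mul, v, LinearMap.comp_apply, Submodule.subtype_apply]
  have hv : LinearIndependent K v := Fintype.linearIndependent_iff.2 fun c hc i => by
    have hzero : ∑ i : Fin _, monomial (i : ℕ) (c i) = 0 :=
      eq_zero_of_degree_lt_finrank hb (degree_sum_monomial_lt c) fun x hx => by
        rw [LinearMap.mem_ker, sum_apply c ⟨x, hx⟩, hc, LinearMap.zero_apply]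
    rw [← coeff_sum_monomial c i, hzero, coeff_zero]
  have : Module.Finite K (V →ₗ[FixedField K] K) := Module.Finite.linearMap _ _ _ _
  have hspan := hv.span_eq_top_of_card_eq_finrank'
    (by rw [Fintype.card_fin, Module.finrank_linearMap_self])
  obtain ⟨c, rfl⟩ := (Submodule.mem_span_range_iff_exists_fun K).1
    (hspan ▸ Submodule.mem_top : T ∈ Submodule.span K (Set.range v))
  exact ⟨_, sum_apply c⟩

end FullKernel

noncomputable section EigenringEnd

variable {b : K} {f : SkewPolynomial K}

theorem map_ker_le_of_mem_leftIdealiser {g : SkewPolynomial K} (hg : g ∈ leftIdealiser f) {x : K}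
    (hx : x ∈ LinearMap.ker (operatorEval b f)) :
    operatorEval b g x ∈ LinearMap.ker (operatorEval b f) := by
  obtain ⟨k, hk⟩ := hg
  rw [LinearMap.mem_ker, ← Module.End.mul_apply, ← map_mul, hk, map_mul, Module.End.mul_apply,
    LinearMap.mem_ker.1 hx, map_zero]

/-- The left idealiser of `f` preserves the kernel of `f`; this is its representation there. -/
def leftIdealiserToEnd (b : K) (f : SkewPolynomial K) :
    leftIdealiser f →ₐ[FixedField K]
      Module.End (FixedField K) (LinearMap.ker (operatorEval b f)) where
  toFun g := (operatorEval b g).restrict fun _ hx => map_ker_le_of_mem_leftIdealiser g.2 hx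
  map_one' := LinearMap.ext fun x => Subtype.ext (by simp)
  map_mul' g h := LinearMap.ext fun x => Subtype.ext (by simp)
  map_zero' := LinearMap.ext fun x => Subtype.ext (by simp)
  map_add' g h := LinearMap.ext fun x => Subtype.ext (by simp)
  commutes' r := LinearMap.ext fun x =>
    Subtype.ext (LinearMap.congr_fun ((operatorEval b).commutes r) (x : K))

theorem HasFullKernel.mem_eigenIdeal_iff (hb : b ≠ 0) (hf : HasFullKernel b f)
    {g : leftIdealiser f} : g ∈ eigenIdeal f ↔ leftIdealiserToEnd b f g = 0 := by
  refine (hf.rightDvd_iff hb (g := g)).trans ⟨fun h => ?_, fun h x hx => ?_⟩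
  · exact LinearMap.ext fun x => Subtype.ext (h x.2)
  · exact congrArg Subtype.val (LinearMap.congr_fun h ⟨x, hx⟩)

theorem HasFullKernel.leftIdealiserToEnd_surjective (hb : b ≠ 0) (hf : HasFullKernel b f) :
    Function.Surjective (leftIdealiserToEnd b f) := by
  intro T
  have := finite_ker_operatorEval hb hf.ne_zero
  obtain ⟨g, hg⟩ := exists_operatorEval_eq hb _ ((LinearMap.ker (operatorEval b f)).subtype ∘ₗ T)
  have hgf : g ∈ leftIdealiser f := (hf.rightDvd_iff hb).2 fun x hx => by
    rw [LinearMap.mem_ker, map_mul, Module.End.mul_apply, hg ⟨x, hx⟩]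
    exact (T ⟨x, hx⟩).2
  exact ⟨⟨g, hgf⟩, LinearMap.ext fun x => Subtype.ext (hg x)⟩

/-- The eigenring of a skew polynomial with full kernel is the whole endomorphism algebra of that
kernel. -/
def HasFullKernel.eigenringEquivEnd (hb : b ≠ 0) (hf : HasFullKernel b f) :
    Eigenring f ≃ₐ[FixedField K]
      Module.End (FixedField K) (LinearMap.ker (operatorEval b f)) :=
  AlgEquiv.ofBijective
    (Ideal.Quotient.liftₐ (eigenIdeal f) (leftIdealiserToEnd b f) fun _ =>
      (hf.mem_eigenIdeal_iff hb).1)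
    ⟨(injective_iff_map_eq_zero _).2 fun y hy => by
      obtain ⟨g, rfl⟩ := Ideal.Quotient.mk_surjective y
      exact Ideal.Quotient.eq_zero_iff_mem.2 ((hf.mem_eigenIdeal_iff hb).2 hy),
    Ideal.Quotient.lift_surjective_of_surjective _ _ (hf.leftIdealiserToEnd_surjective hb)⟩

theorem HasFullKernel.isAPolynomial (hb : b ≠ 0) (hf : HasFullKernel b f) {m : ℕ}
    (hdeg : degree f = m) (hm : 1 ≤ m) : IsAPolynomial f := by
  have := finite_ker_operatorEval hb hf.ne_zero
  have : Nonempty (Fin m) := ⟨⟨0, hm⟩⟩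
  let e := hf.eigenringEquivEnd hb
  let B := Module.finBasisOfFinrankEq (FixedField K) (LinearMap.ker (operatorEval b f))
    (Nat.cast_injective (hf.symm.trans hdeg))
  exact ⟨Algebra.IsCentral.of_algEquiv _ _ _ e.symm,
    IsSimpleRing.of_ringEquiv ((algEquivMatrix B).symm.trans e.symm).toRingEquiv
      (IsSimpleRing.matrix _ _),
    Module.Finite.equiv (e.trans (algEquivMatrix B)).symm.toLinearEquiv⟩

end EigenringEnd

section Factorization

theorem prod_X_sub_C_succ (a : ℕ → K) (m : ℕ) :
    ((List.range (m + 1)).map fun i => X - C (a i)).prod =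
      ((List.range m).map fun i => X - C (a i)).prod * (X - C (a m)) :=
  List.prod_range_succ _ m

theorem degree_prod_X_sub_C (a : ℕ → K) (m : ℕ) :
    degree ((List.range m).map fun i => X - C (a i)).prod = m := by
  induction m with
  | zero => simpa using degree_X_pow (K := K) 0
  | succ m ih => rw [prod_X_sub_C_succ, degree_mul, ih, degree_X_sub_C, Nat.cast_succ]

theorem isReducible_prod_X_sub_C (a : ℕ → K) {m : ℕ} (hm : 1 < m) :
    IsReducible ((List.range m).map fun i => X - C (a i)).prod := by
  obtain ⟨m, rfl⟩ := Nat.exists_eq_add_of_lt hm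
  rw [prod_X_sub_C_succ]
  refine isReducible_mul ?_ ?_
  · rw [degree_prod_X_sub_C]
    exact Nat.cast_pos.2 (Nat.add_pos_left one_pos m)
  · rw [degree_X_sub_C]
    exact zero_lt_one

theorem HasFullKernel.exists_eq_prod {b : K} (hb : b ≠ 0) {f : SkewPolynomial K} {m : ℕ}
    (hf : HasFullKernel b f) (hdeg : degree f = m) (hmonic : coeff f m = 1) :
    ∃ c : ℕ → Kˣ, f = ((List.range m).map fun i => X - C (Omega (c (i + 1)) b)).prod := by
  induction m generalizing f with
  | zero =>
    refine ⟨1, ?_⟩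
    rw [eq_C_of_degree_lt_one (hdeg.trans_lt (Nat.cast_lt.2 zero_lt_one)), hmonic, C_1]
    rfl
  | succ m ih =>
    have hker : LinearMap.ker (operatorEval b f) ≠ ⊥ := fun h => by
      rw [HasFullKernel, hdeg, h, finrank_bot, Nat.cast_inj] at hf
      exact Nat.succ_ne_zero m hf
    obtain ⟨w, hw, hw0⟩ := Submodule.exists_mem_ne_zero_of_ne_bot hker
    obtain ⟨k, rfl⟩ := (rightDvd_X_sub_C_Omega_iff (w := Units.mk0 w hw0)).2 hw
    have hk : degree k = m := degree_of_degree_mul_X_sub_C hdeg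
    obtain ⟨c, hc⟩ := ih (hf.of_mul hb).1 hk (by rwa [coeff_mul_X_sub_C_succ hk.le] at hmonic)
    refine ⟨Function.update c (m + 1) (Units.mk0 w hw0), ?_⟩
    rw [prod_X_sub_C_succ fun i => Omega (Function.update c (m + 1) (Units.mk0 w hw0) (i + 1)) b,
      Function.update_self, hc]
    congr 2
    refine List.map_congr_left fun i hi => ?_
    rw [Function.update_of_ne (Nat.succ_ne_succ_iff.2 (List.mem_range.1 hi).ne)]

theorem exists_normalized_Omega (c : ℕ → Kˣ) {b : K} (hb : b ≠ 0) (m : ℕ) :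
    ∃ (c' : ℕ → Kˣ) (b' : Kˣ), c' m = 1 ∧ ∀ i, Omega (c' i) (b' : K) = Omega (c i) b :=
  ⟨fun i => c i / c m, Units.mk0 _ (Omega_ne_zero (c m) hb), div_self' _,
    fun i => Omega_div_Omega (c i) (c m) b⟩

end Factorization

section Center

theorem exists_rightDvd_sub_algebraMap {f z : SkewPolynomial K}
    [Algebra.IsCentral (FixedField K) (Eigenring f)]
    (hz : z ∈ Subring.center (SkewPolynomial K)) :
    ∃ a : FixedField K, f.RightDvd (z - algebraMap _ _ a) := by
  rw [Subring.mem_center_iff] at hz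
  let z' : leftIdealiser f := ⟨z, z, hz f⟩
  have hz' : Ideal.Quotient.mk (eigenIdeal f) z' ∈
      Subalgebra.center (FixedField K) (Eigenring f) := by
    rw [Subalgebra.mem_center_iff]
    intro y
    obtain ⟨g, rfl⟩ := Ideal.Quotient.mk_surjective y
    rw [← map_mul, ← map_mul]
    exact congrArg _ (Subtype.ext (hz g))
  obtain ⟨a, ha⟩ := Algebra.mem_bot.1 (Algebra.IsCentral.out hz')
  exact ⟨a, Ideal.Quotient.eq.1 (show Ideal.Quotient.mk (eigenIdeal f) z' =
    Ideal.Quotient.mk (eigenIdeal f) (algebraMap _ _ a) from ha.symm)⟩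

theorem eq_X_sub_C_of_rightDvd_aeval {b : K} {z : SkewPolynomial K} {a : FixedField K}
    (hz : operatorEval b z = algebraMap _ _ a) {p : Polynomial (FixedField K)} (hp : p.Monic)
    (hirr : Irreducible p) (h : (X - C b).RightDvd (Polynomial.aeval z p)) :
    p = Polynomial.X - Polynomial.C a := by
  have happly := (rightDvd_X_sub_C_Omega_iff (b := b) (w := 1)).1 (by rwa [Omega_one])
  have hroot : p.IsRoot a := by
    rw [Units.val_one, ← Polynomial.aeval_algHom_apply, hz, Polynomial.aeval_algebraMap_apply,
      Module.algebraMap_end_apply, Algebra.smul_def, mul_one,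
      map_eq_zero_iff _ (algebraMap (FixedField K) K).injective] at happly
    simpa only [Polynomial.coe_aeval_eq_eval, Polynomial.IsRoot] using happly
  exact (Polynomial.eq_of_monic_of_associated (Polynomial.monic_X_sub_C _) hp
    ((Polynomial.irreducible_X_sub_C _).associated_of_dvd hirr
      (Polynomial.dvd_iff_isRoot.2 hroot))).symm

end Center

noncomputable section Cyclic

variable [FiniteDimensional (FixedField K) K]

variable (K) in
/-- The twist `σ`, as an automorphism of `K` over its fixed field. -/
def twistAut : K ≃ₐ[FixedField K] K :=
  AlgEquiv.ofBijective
    (MulSemiringAction.toAlgHom (FixedField K) K (Multiplicative.ofAdd 1 : Multiplicative ℕ))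
    (AlgHom.bijective _)

theorem twistAut_pow_apply (i : ℕ) (x : K) : (twistAut K ^ i) x = (φ : K →+* K)^[i] x := by
  rw [AlgEquiv.coe_pow]
  rfl

theorem fixedField_zpowers_twistAut :
    IntermediateField.fixedField (Subgroup.zpowers (twistAut K)) = ⊥ := by
  refine eq_bot_iff.2 fun x hx => IntermediateField.mem_bot.2 ⟨⟨x, ?_⟩, rfl⟩
  exact (mem_fixedField_iff x).2 (hx ⟨twistAut K, Subgroup.mem_zpowers _⟩)

theorem zpowers_twistAut : Subgroup.zpowers (twistAut K) = ⊤ := by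
  rw [← IntermediateField.fixingSubgroup_fixedField (Subgroup.zpowers (twistAut K)),
    fixedField_zpowers_twistAut, IntermediateField.fixingSubgroup_bot]

instance isGalois_fixedField : IsGalois (FixedField K) K :=
  IsGalois.of_fixedField_eq_bot _ _ (zpowers_twistAut (K := K) ▸ fixedField_zpowers_twistAut)

theorem orderOf_twistAut : orderOf (twistAut K) = Module.finrank (FixedField K) K := by
  rw [← Nat.card_zpowers, zpowers_twistAut, Subgroup.card_top, IsGalois.card_aut_eq_finrank]

theorem iterate_φ_finrank (x : K) :
    (φ : K →+* K)^[Module.finrank (FixedField K) K] x = x := by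
  rw [← twistAut_pow_apply, ← orderOf_twistAut, pow_orderOf_eq_one, AlgEquiv.one_apply]

theorem algebraMap_norm_eq_prod_iterate_φ (b : K) :
    algebraMap (FixedField K) K (Algebra.norm (FixedField K) b) =
      ∏ j ∈ Finset.range (Module.finrank (FixedField K) K), (φ : K →+* K)^[j] b := by
  classical
  have himage := IsCyclic.image_range_orderOf (a := twistAut K) fun g =>
    zpowers_twistAut (K := K) ▸ Subgroup.mem_top g
  have hinj : Set.InjOn (fun i : ℕ => twistAut K ^ i) (Finset.range (orderOf (twistAut K))) :=
    (Finset.coe_range _).symm ▸ pow_injOn_Iio_orderOf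
  rw [Algebra.norm_eq_prod_automorphisms, ← himage, Finset.prod_image hinj, orderOf_twistAut]
  exact Finset.prod_congr rfl fun j _ => twistAut_pow_apply j b

theorem pseudoLinear_pow_finrank (b : K) :
    pseudoLinear b ^ Module.finrank (FixedField K) K =
      algebraMap _ _ (Algebra.norm (FixedField K) b) := by
  ext x
  rw [pseudoLinear_pow_apply, iterate_φ_finrank, ← algebraMap_norm_eq_prod_iterate_φ,
    Module.algebraMap_end_apply, Algebra.smul_def]

theorem X_pow_finrank_mem_center :
    (X : SkewPolynomial K) ^ Module.finrank (FixedField K) K ∈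
      Subring.center (SkewPolynomial K) := by
  refine Subring.mem_center_iff.2 fun p => ?_
  simp only [X_pow_mul, iterate_φ_finrank, sum_monomial]

theorem hasFullKernel_X_pow_sub_norm (b : K) :
    HasFullKernel b (X ^ Module.finrank (FixedField K) K -
      algebraMap (FixedField K) _ (Algebra.norm (FixedField K) b)) := by
  have hzero : operatorEval b (X ^ Module.finrank (FixedField K) K -
      algebraMap (FixedField K) _ (Algebra.norm (FixedField K) b)) = 0 := by
    rw [map_sub, map_pow, operatorEval_X, AlgHom.commutes, pseudoLinear_pow_finrank, sub_self]
  rw [HasFullKernel, hzero, LinearMap.ker_zero, finrank_top]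
  exact degree_X_pow_sub_C Module.finrank_pos.ne' _

theorem HasFullKernel.degree_le_finrank {b : K} {f : SkewPolynomial K}
    (hf : HasFullKernel b f) : degree f ≤ Module.finrank (FixedField K) K :=
  hf.trans_le (Nat.cast_le.2 (Submodule.finrank_le _))

theorem hasFullKernel_of_rightDvd {b : K} (hb : b ≠ 0) {f : SkewPolynomial K}
    (hf : f.RightDvd (X ^ Module.finrank (FixedField K) K -
      algebraMap (FixedField K) _ (Algebra.norm (FixedField K) b))) : HasFullKernel b f := by
  obtain ⟨g, hg⟩ := hf
  exact (HasFullKernel.of_mul hb (hg ▸ hasFullKernel_X_pow_sub_norm b)).2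

theorem exists_hasFullKernel_of_isAPolynomial {f : SkewPolynomial K} (hA : IsAPolynomial f)
    (hnorm : Function.Surjective (Algebra.norm (FixedField K) : K → FixedField K))
    (hf0 : coeff f 0 ≠ 0) (hdeg : degree f ≠ 0) : ∃ b : K, b ≠ 0 ∧ HasFullKernel b f := by
  have := hA.1
  obtain ⟨a, ha⟩ := exists_rightDvd_sub_algebraMap (f := f) X_pow_finrank_mem_center
  obtain ⟨b, rfl⟩ := hnorm a
  have hb : b ≠ 0 := by
    rintro rfl
    rw [Algebra.norm_zero, map_zero, sub_zero] at ha
    exact hdeg (degree_eq_zero_of_rightDvd_X_pow hf0 ha)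
  exact ⟨b, hb, hasFullKernel_of_rightDvd hb ha⟩

theorem hasFullKernel_of_rightDvd_aeval {b : K} (hb : b ≠ 0) {f k : SkewPolynomial K}
    (hf : f = k * (X - C b)) {p : Polynomial (FixedField K)} (hp : p.Monic)
    (hirr : Irreducible p)
    (h : f.RightDvd (Polynomial.aeval (X ^ Module.finrank (FixedField K) K) p)) :
    HasFullKernel b f := by
  have hz : operatorEval b (X ^ Module.finrank (FixedField K) K) =
      algebraMap _ _ (Algebra.norm (FixedField K) b) := by
    rw [map_pow, operatorEval_X, pseudoLinear_pow_finrank]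
  have hlin : p = Polynomial.X - Polynomial.C (Algebra.norm (FixedField K) b) := by
    obtain ⟨g, hg⟩ := h
    exact eq_X_sub_C_of_rightDvd_aeval hz hp hirr ⟨g * k, by rw [hg, hf, mul_assoc]⟩
  rw [hlin, map_sub, Polynomial.aeval_X, Polynomial.aeval_C] at h
  exact hasFullKernel_of_rightDvd hb h

end Cyclic

section FiniteField

theorem iterate_φ_eq_pow {q : ℕ} (hσ : ∀ a : K, (φ : K →+* K) a = a ^ q) (i : ℕ) (x : K) :
    (φ : K →+* K)^[i] x = x ^ q ^ i := by
  rw [funext hσ, pow_iterate]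

theorem finrank_fixedField_of_card [Finite K] {q n : ℕ} (hq : 2 ≤ q) (hK : Nat.card K = q ^ n)
    (hσ : ∀ a : K, (φ : K →+* K) a = a ^ q) : Module.finrank (FixedField K) K = n := by
  cases nonempty_fintype K
  rw [Nat.card_eq_fintype_card] at hK
  have hn : n ≠ 0 := by
    rintro rfl
    exact Fintype.one_lt_card.ne' hK
  refine le_antisymm ?_ ?_
  · have hpow : twistAut K ^ n = 1 := AlgEquiv.ext fun x => by
      rw [twistAut_pow_apply, iterate_φ_eq_pow hσ, ← hK, FiniteField.pow_card, AlgEquiv.one_apply]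
    rw [← orderOf_twistAut]
    exact orderOf_le_of_pow_eq_one hn.pos hpow
  · set d := Module.finrank (FixedField K) K
    have hqd : 1 < q ^ d := Nat.one_lt_pow Module.finrank_pos.ne' hq
    have hroot (x : Kˣ) : x ^ (q ^ d - 1) = 1 := by
      refine Units.ext (mul_left_cancel₀ x.ne_zero ?_)
      rw [Units.val_pow_eq_pow_val, ← pow_succ', Nat.sub_add_cancel hqd.le, ← iterate_φ_eq_pow hσ,
        iterate_φ_finrank, Units.val_one, mul_one]
    have hdvd := (FiniteField.forall_pow_eq_one_iff K _).1 hroot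
    have hle := Nat.le_of_dvd (Nat.sub_pos_of_lt hqd) hdvd
    rw [hK] at hle
    exact (Nat.pow_le_pow_iff_right hq).1 (by lia)

end FiniteField

end SkewPoly

section General

open SkewPolynomial SkewPoly

theorem corollary7_general {K : Type*} [Field K] [MulSemiringAction (Multiplicative ℕ) K]
    [FiniteDimensional (FixedField K) K]
    (hnorm : Function.Surjective (Algebra.norm (FixedField K) : K → FixedField K))
    (f : SkewPolynomial K) (m : ℕ) (hm : 1 ≤ m) (hdeg : degree f = m) (hmonic : coeff f m = 1)
    (hft : IsGCRD f X 1) (p : Polynomial (FixedField K)) (hp : p.Monic) (hirr : Irreducible p)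
    (hfp : f.RightDvd (Polynomial.aeval (X ^ Module.finrank (FixedField K) K) p)) :
    (IsAPolynomial f ↔
      m ≤ Module.finrank (FixedField K) K ∧ ∃ (c : ℕ → Kˣ) (b : Kˣ), c m = 1 ∧
        f = ((List.range m).map fun i => X - C (Omega (c (i + 1)) (b : K))).prod) ∧
    (IsAPolynomial f → m ≠ 1 → IsReducible f) := by
  have hdeg_ne : degree f ≠ 0 := hdeg ▸ Nat.cast_ne_zero.2 (Nat.ne_zero_of_lt hm)
  have forward (hA : IsAPolynomial f) :
      m ≤ Module.finrank (FixedField K) K ∧ ∃ (c : ℕ → Kˣ) (b : Kˣ), c m = 1 ∧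
        f = ((List.range m).map fun i => X - C (Omega (c (i + 1)) (b : K))).prod := by
    obtain ⟨b, hb, hfull⟩ := exists_hasFullKernel_of_isAPolynomial hA hnorm
      (coeff_zero_ne_zero_of_isGCRD hft) hdeg_ne
    obtain ⟨c, hc⟩ := hfull.exists_eq_prod hb hdeg hmonic
    obtain ⟨c', b', hc', hΩ⟩ := exists_normalized_Omega c hb m
    exact ⟨Nat.cast_le.1 (hdeg ▸ hfull.degree_le_finrank), c', b', hc', by simpa only [hΩ]⟩
  refine ⟨⟨forward, ?_⟩, fun hA hm1 => ?_⟩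
  · rintro ⟨-, c, b, hc, hprod⟩
    obtain ⟨m, rfl⟩ := Nat.exists_eq_add_of_le' hm
    rw [prod_X_sub_C_succ fun i => Omega (c (i + 1)) (b : K), hc, Omega_one] at hprod
    have hfull := hasFullKernel_of_rightDvd_aeval b.ne_zero hprod hp hirr hfp
    exact hfull.isAPolynomial b.ne_zero hdeg hm
  · obtain ⟨-, c, b, -, rfl⟩ := forward hA
    exact isReducible_prod_X_sub_C (fun i => Omega (c (i + 1)) (b : K)) (hm.lt_of_ne' hm1)

end General

theorem corollary7 {K : Type*} [Field K] [Finite K] (q n : ℕ) (hq : IsPrimePow q)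
    (hK : Nat.card K = q ^ n)
    [MulSemiringAction (Multiplicative ℕ) K]
    (hσ : ∀ a : K, (SkewPolynomial.φ : K →+* K) a = a ^ q)
    (f : SkewPolynomial K) (m : ℕ) (hm : 1 ≤ m)
    (hdeg : SkewPolynomial.degree f = (m : WithBot ℕ))
    (hmonic : SkewPolynomial.coeff f m = 1)
    (hft : SkewPolynomial.IsGCRD f SkewPolynomial.X 1)
    (hhat : Polynomial (SkewPolynomial.FixedField K))
    (hhat_monic : hhat.Monic) (hhat_irr : Irreducible hhat)
    (hh : SkewPolynomial.IsMinimalCentralLeftMultiple f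
      (Polynomial.aeval ((SkewPolynomial.X : SkewPolynomial K) ^ n) hhat)) :
    (SkewPolynomial.IsAPolynomial f ↔
      m ≤ n ∧ ∃ (c : ℕ → Kˣ) (b : Kˣ), c m = 1 ∧
        f = ((List.range m).map fun i : ℕ =>
          (SkewPolynomial.X : SkewPolynomial K) -
            SkewPolynomial.C (SkewPolynomial.Omega (c (i + 1)) (b : K))).prod) ∧
    (SkewPolynomial.IsAPolynomial f → m ≠ 1 → SkewPolynomial.IsReducible f) := by
  obtain rfl := SkewPoly.finrank_fixedField_of_card hq.two_le hK hσ
  exact corollary7_general (FiniteField.norm_surjective _ K) f m hm hdeg hmonic hft hhat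
    hhat_monic hhat_irr hh.2.2.1
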